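/- Let $a>0$, $\alpha\in(0,1)$ and $\alpha'=\sqrt{1-\alpha^2}$. Let $\operatorname{sn}(\cdot\,;\alpha)$ denote the Jacobi elliptic sine of modulus $\alpha$, that is, $\operatorname{sn}(t;\alpha)=\sin\varphi$ where $\varphi\in\mathbb R$ is determined by $t=\int_0^{\varphi}\frac{d\theta}{\sqrt{1-\alpha^2\sin^2\theta}}$, and let $\mathrm K(\alpha)=\int_0^{\pi/2}\frac{d\theta}{\sqrt{1-\alpha^2\sin^2\theta}}$ be the complete elliptic integral of the first kind. Then for every $(x,y)\in\mathbb R^2$ the equation $$\operatorname{sn}\left(\frac{az}{\alpha'};\alpha\right)=\frac{\cos ax}{\cosh ay}$$ has exactly one real solution $z=u_{a,\alpha}(x,y)$ in the slab $\left|\frac{az}{\alpha'}\right|\le \mathrm K(\alpha)$. The function $u=u_{a,\alpha}$ so defined is continuous on $\mathbb R^2$. Let $\Sigma=\{(\pi k/a,0): k\in\mathbb Z\}$. On $\mathbb R^2\setminus\Sigma$ the function $u$ is real analytic, it is space-like, i.e. $|\nabla u|=\sqrt{u_x^2+u_y^2}<1$, and it solves the maximal surface equation $$(1-u_y^2)\,u_{xx}+2u_xu_y\,u_{xy}+(1-u_x^2)\,u_{yy}=0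 .$$ At the points of $\Sigma$ the function $u$ is not real analytic. -/

import Mathlib

noncomputable section

/-- The incomplete elliptic integral of the first kind with modulus `k`, in Legendre form
`F(φ, k) = ∫₀^φ dθ / √(1 - k² sin² θ)`. -/
def ellipticF (k φ : ℝ) : ℝ :=
  ∫ θ in (0 : ℝ)..φ, 1 / Real.sqrt (1 - k ^ 2 * Real.sin θ ^ 2)

/-- The complete elliptic integral of the first kind `K(k) = F(π/2, k)`. -/
def ellipticK (k : ℝ) : ℝ := ellipticF k (Real.pi / 2)

/-- The Jacobi amplitude: the inverse function of `φ ↦ F(φ, k)`, which is a bijection of `ℝ`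
for `|k| < 1` (`ellipticF_bijective` below). -/
def jacobiAm (t k : ℝ) : ℝ := Function.invFun (ellipticF k) t

/-- The Jacobi elliptic sine `sn(t; k) = sin (am(t; k))`, for all real `t`.  Substituting
`u = sin θ`, for `|t| ≤ K(k)` this is the inverse of
`s ↦ ∫₀^s du / √((1 - u²)(1 - k² u²))` on `[-1, 1]`. -/
def jacobiSn (t k : ℝ) : ℝ := Real.sin (jacobiAm t k)

/-- The partial derivative `u_x`. -/
def partialX (u : ℝ × ℝ → ℝ) (p : ℝ × ℝ) : ℝ := deriv (fun s => u (s, p.2)) p.1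

/-- The partial derivative `u_y`. -/
def partialY (u : ℝ × ℝ → ℝ) (p : ℝ × ℝ) : ℝ := deriv (fun s => u (p.1, s)) p.2

/-- The equation `(1 - u_y²) u_xx + 2 u_x u_y u_xy + (1 - u_x²) u_yy = 0` at the point `p`. -/
def MaximalSurfaceEqAt (u : ℝ × ℝ → ℝ) (p : ℝ × ℝ) : Prop :=
  (1 - partialY u p ^ 2) * partialX (partialX u) p
    + 2 * partialX u p * partialY u p * partialY (partialX u) p
    + (1 - partialX u p ^ 2) * partialY (partialY u) p = 0

/-- The graph of `u` is space-like at `p`: `|∇u(p)| < 1`, with the Euclidean length. -/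
def SpaceLikeAt (u : ℝ × ℝ → ℝ) (p : ℝ × ℝ) : Prop :=
  Real.sqrt (partialX u p ^ 2 + partialY u p ^ 2) < 1

/-- `u` is a space-like `C²` solution of the maximal surface equation on the open set `U`. -/
structure IsSpaceLikeSolutionOn (u : ℝ × ℝ → ℝ) (U : Set (ℝ × ℝ)) : Prop where
  isOpen : IsOpen U
  contDiffOn : ContDiffOn ℝ 2 u U
  spaceLike : ∀ p ∈ U, SpaceLikeAt u p
  equation : ∀ p ∈ U, MaximalSurfaceEqAt u p

/-- The set of points `(πk/a, 0)`, `k ∈ ℤ`. -/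
def singularPoints (a : ℝ) : Set (ℝ × ℝ) :=
  {p | ∃ k : ℤ, p = (Real.pi * k / a, 0)}

theorem ellipticF_integrand_pos {k : ℝ} (hk : |k| < 1) (θ : ℝ) :
    0 < 1 - k ^ 2 * Real.sin θ ^ 2 := by
  have h1 : k ^ 2 < 1 := (sq_lt_one_iff_abs_lt_one k).2 hk
  nlinarith [Real.sin_sq_le_one θ, sq_nonneg (Real.sin θ), sq_nonneg k]

theorem ellipticF_integrand_continuous {k : ℝ} (hk : |k| < 1) :
    Continuous fun θ : ℝ => 1 / Real.sqrt (1 - k ^ 2 * Real.sin θ ^ 2) := by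
  refine continuous_const.div (by fun_prop) fun θ => ?_
  exact (Real.sqrt_pos.2 (ellipticF_integrand_pos hk θ)).ne'

theorem ellipticF_hasDerivAt {k : ℝ} (hk : |k| < 1) (φ : ℝ) :
    HasDerivAt (ellipticF k) (1 / Real.sqrt (1 - k ^ 2 * Real.sin φ ^ 2)) φ :=
  ((ellipticF_integrand_continuous hk).integral_hasStrictDerivAt 0 φ).hasDerivAt

theorem ellipticF_sub_id_monotone {k : ℝ} (hk : |k| < 1) :
    Monotone fun φ => ellipticF k φ - φ := by
  have hd : ∀ φ, HasDerivAt (fun φ => ellipticF k φ - φ)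
      (1 / Real.sqrt (1 - k ^ 2 * Real.sin φ ^ 2) - 1) φ := fun φ =>
    (ellipticF_hasDerivAt hk φ).sub (hasDerivAt_id φ)
  refine monotone_of_deriv_nonneg (fun φ => (hd φ).differentiableAt) fun φ => ?_
  rw [(hd φ).deriv, sub_nonneg, le_div_iff₀ (Real.sqrt_pos.2 (ellipticF_integrand_pos hk φ)),
    one_mul]
  refine Real.sqrt_le_iff.2 ⟨zero_le_one, ?_⟩
  nlinarith [mul_nonneg (sq_nonneg k) (sq_nonneg (Real.sin φ))]

theorem ellipticF_zero (k : ℝ) : ellipticF k 0 = 0 := by simp [ellipticF]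

theorem ellipticF_bijective {k : ℝ} (hk : |k| < 1) : Function.Bijective (ellipticF k) := by
  have hm := ellipticF_sub_id_monotone hk
  have hc : Continuous (ellipticF k) :=
    continuous_iff_continuousAt.2 fun φ => (ellipticF_hasDerivAt hk φ).continuousAt
  constructor
  · have hs : StrictMono (ellipticF k) := fun x y hxy => by
      have := hm hxy.le
      simp only at this
      linarith
    exact hs.injective
  · refine hc.surjective ?_ ?_
    · refine Filter.tendsto_atTop_mono' _ ?_ Filter.tendsto_id
      filter_upwards [Filter.eventually_ge_atTop 0] with x hx
      have := hm hx
      simp only [ellipticF_zero] at this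
      simp only [id]
      linarith
    · refine Filter.tendsto_atBot_mono' _ ?_ Filter.tendsto_id
      filter_upwards [Filter.eventually_le_atBot 0] with x hx
      have := hm hx
      simp only [ellipticF_zero] at this
      simp only [id]
      linarith

end

/-!
Since `c ↦ F(arcsin c, α)` inverts `sn` on `[-K, K]`, the solution is `u = φ ∘ q` with
`q = cos (a x) / cosh (a y)` and `φ' = β / √R`, where `R(c) = (1 - c²)(1 - α² c²)` and
`β = √(1 - α²) / a`. For such a composition the maximal surface equation becomes
`R(q) Δq - ½ R'(q) |∇q|² = β² D²q(∇⊥q, ∇⊥q)`. Each of `Δq`, `|∇q|²` and `D²q(∇⊥q, ∇⊥q)` is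
`1 / cosh² (a y)` times a polynomial in `q`, namely `-2 a² q`, `a² (1 - q²)` and
`-a⁴ q (1 - q²)`, so the equation reduces to a polynomial identity in `q` that holds because
`β² a² = 1 - α²`. Moreover `|∇u|² = (1 - α²) / (cosh² (a y) - α² cos² (a x))`, which is less
than `1` away from the singular points. At a singular point `u_y = 0` because `u` is even in `y`,
whereas `u_x = 0` and therefore `u_y² → 1` along the vertical line through that point, so that `u`
is not even `C¹` there.
-/

open Filter Topology
open scoped ContDiff

section Primitive

variable {𝕜 E : Type*} [RCLike 𝕜] [NormedAddCommGroup E] [NormedSpace 𝕜 E]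

/-- The term-by-term primitive of a power series in one variable. Its constant term vanishes because
`0⁻¹ = 0`. -/
noncomputable def primitiveSeries (p : FormalMultilinearSeries 𝕜 𝕜 E) :
    FormalMultilinearSeries 𝕜 𝕜 E := fun n =>
  ContinuousMultilinearMap.mkPiRing 𝕜 (Fin n) ((n : 𝕜)⁻¹ • p.coeff (n - 1))

theorem coeff_primitiveSeries (p : FormalMultilinearSeries 𝕜 𝕜 E) (n : ℕ) :
    (primitiveSeries p).coeff n = (n : 𝕜)⁻¹ • p.coeff (n - 1) := by
  rw [FormalMultilinearSeries.coeff, primitiveSeries, ContinuousMultilinearMap.mkPiRing_apply]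
  simp only [Pi.one_apply, Finset.prod_const_one, one_smul]

theorem coeff_derivSeries_primitiveSeries (p : FormalMultilinearSeries 𝕜 𝕜 E) (n : ℕ) :
    (primitiveSeries p).derivSeries.coeff n 1 = p.coeff n := by
  rw [FormalMultilinearSeries.derivSeries_coeff_one, coeff_primitiveSeries,
    ← Nat.cast_smul_eq_nsmul 𝕜, smul_smul, mul_inv_cancel₀ (by exact_mod_cast n.succ_ne_zero),
    one_smul, Nat.add_sub_cancel]

theorem radius_le_radius_primitiveSeries (p : FormalMultilinearSeries 𝕜 𝕜 E) :
    p.radius ≤ (primitiveSeries p).radius := by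
  refine ENNReal.le_of_forall_nnreal_lt fun r hr => ?_
  obtain ⟨C, hC, hp⟩ := p.norm_mul_pow_le_of_lt_radius hr
  refine (primitiveSeries p).le_radius_of_bound (C * r) fun n => ?_
  rw [FormalMultilinearSeries.norm_apply_eq_norm_coef, coeff_primitiveSeries]
  cases n with
  | zero => simpa using by positivity
  | succ n =>
    have hinv : ‖((n + 1 : ℕ) : 𝕜)⁻¹‖ ≤ 1 := by
      rw [norm_inv, RCLike.norm_natCast]
      exact inv_le_one_of_one_le₀ (by simp)
    calc ‖((n + 1 : ℕ) : 𝕜)⁻¹ • p.coeff n‖ * (r : ℝ) ^ (n + 1)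
        ≤ 1 * ‖p.coeff n‖ * (r : ℝ) ^ (n + 1) := by rw [norm_smul]; gcongr
      _ = ‖p n‖ * (r : ℝ) ^ n * r := by
        rw [FormalMultilinearSeries.norm_apply_eq_norm_coef]; ring
      _ ≤ C * r := by gcongr; exact hp n

theorem hasDerivAt_primitiveSeries_sum [CompleteSpace E] (p : FormalMultilinearSeries 𝕜 𝕜 E)
    {z : 𝕜} (hz : ‖z‖ₑ < p.radius) : HasDerivAt (primitiveSeries p).sum (p.sum z) z := by
  have hz' := hz.trans_le (radius_le_radius_primitiveSeries p)
  have hsum := (primitiveSeries p).derivSeries.summable (x := z)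
    (by simpa using! hz'.trans_le (primitiveSeries p).radius_le_radius_derivSeries)
  convert (FormalMultilinearSeries.hasFDerivAt_sum hz').hasDerivAt using 1
  change _ = ContinuousLinearMap.apply 𝕜 E (1 : 𝕜)
    (∑' n, (primitiveSeries p).derivSeries n fun _ => z)
  rw [ContinuousLinearMap.map_tsum _ hsum, FormalMultilinearSeries.sum]
  simp only [FormalMultilinearSeries.apply_eq_pow_smul_coeff, ContinuousLinearMap.apply_apply,
    smul_apply, coeff_derivSeries_primitiveSeries]

theorem analyticAt_of_eventually_hasDerivAt [CompleteSpace E] {f f' : 𝕜 → E} {x : 𝕜}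
    (hf' : AnalyticAt 𝕜 f' x) (hf : ∀ᶠ z in 𝓝 x, HasDerivAt f (f' z) z) : AnalyticAt 𝕜 f x := by
  obtain ⟨p, r, hp⟩ := hf'
  have hp_pos : 0 < p.radius := hp.r_pos.trans_le hp.r_le
  set F : 𝕜 → E := fun z => (primitiveSeries p).sum (z - x)
  have hF : AnalyticAt 𝕜 F x := by
    have h := ((primitiveSeries p).hasFPowerSeriesOnBall
      (hp_pos.trans_le (radius_le_radius_primitiveSeries p))).analyticAt
    simpa using! h.comp_sub x
  have hF' : ∀ᶠ z in 𝓝 x, HasDerivAt F (f' z) z := by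
    filter_upwards [Metric.eball_mem_nhds x hp.r_pos] with z hz
    have hzr : ‖z - x‖ₑ < r := by simpa [edist_eq_enorm_sub] using hz
    have h := (hasDerivAt_primitiveSeries_sum p (hzr.trans_le hp.r_le)).comp_sub_const z x
    rwa [← hp.sum (by simpa using hzr), add_sub_cancel] at h
  have hfF : f =ᶠ[𝓝 x] fun z => F z + (f x - F x) := by
    obtain ⟨ε, hε, hball⟩ := Metric.eventually_nhds_iff_ball.1 (hf.and hF')
    have hxε := Metric.mem_ball_self hε (x := x)
    filter_upwards [Metric.ball_mem_nhds x hε]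
    exact Metric.isOpen_ball.eqOn_of_deriv_eq (convex_ball x ε |>.isPreconnected)
      (fun z hz => (hball z hz).1.differentiableAt.differentiableWithinAt)
      (fun z hz => ((hball z hz).2.add_const _).differentiableAt.differentiableWithinAt)
      (fun z hz => (hball z hz).1.deriv.trans ((hball z hz).2.add_const _).deriv.symm)
      hxε (by simp)
  exact (hF.add analyticAt_const).congr hfF.symm

end Primitive

section LineDeriv

variable {𝕜 E F : Type*} [NontriviallyNormedField 𝕜] [NormedAddCommGroup E] [NormedSpace 𝕜 E]
  [NormedAddCommGroup F] [NormedSpace 𝕜 F] {p : E}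

theorem lineDeriv_comp {u : E → 𝕜} {φ : 𝕜 → 𝕜} {φ' : 𝕜} {v : E} (hφ : HasDerivAt φ φ' (u p))
    (hu : LineDifferentiableAt 𝕜 u p v) : lineDeriv 𝕜 (φ ∘ u) p v = φ' * lineDeriv 𝕜 u p v := by
  have hφ₀ : HasDerivAt φ φ' (u (p + (0 : 𝕜) • v)) := by rwa [zero_smul, add_zero]
  exact (hφ₀.comp 0 hu.hasLineDerivAt).deriv

theorem lineDeriv_eventuallyEq_fderiv {f : E → F} (hf : ContDiffAt 𝕜 1 f p) (v : E) :
    (fun x => lineDeriv 𝕜 f x v) =ᶠ[𝓝 p] fun x => fderiv 𝕜 f x v := by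
  filter_upwards [hf.eventually (by simp)] with x hx
  exact (hx.differentiableAt one_ne_zero).lineDeriv_eq_fderiv

theorem continuousAt_lineDeriv {f : E → F} (hf : ContDiffAt 𝕜 1 f p) (v : E) :
    ContinuousAt (fun x => lineDeriv 𝕜 f x v) p :=
  ((hf.continuousAt_fderiv one_ne_zero).clm_apply continuousAt_const).congr
    (lineDeriv_eventuallyEq_fderiv hf v).symm

theorem differentiableAt_lineDeriv {f : E → F} (hf : ContDiffAt 𝕜 2 f p) (v : E) :
    DifferentiableAt 𝕜 (fun x => lineDeriv 𝕜 f x v) p := by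
  have hf' : DifferentiableAt 𝕜 (fderiv 𝕜 f) p :=
    (hf.fderiv_right (m := 1) le_rfl).differentiableAt one_ne_zero
  exact (hf'.clm_apply (differentiableAt_const v)).congr_of_eventuallyEq
    (lineDeriv_eventuallyEq_fderiv (hf.of_le one_le_two) v)

theorem lineDeriv_lineDeriv_comp {u : E → 𝕜} {φ φ' : 𝕜 → 𝕜} {φ'' : 𝕜}
    (hu : ContDiffAt 𝕜 2 u p) (hφ : ∀ᶠ c in 𝓝 (u p), HasDerivAt φ (φ' c) c)
    (hφ' : HasDerivAt φ' φ'' (u p)) (v w : E) :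
    lineDeriv 𝕜 (fun x => lineDeriv 𝕜 (φ ∘ u) x v) p w =
      φ'' * lineDeriv 𝕜 u p w * lineDeriv 𝕜 u p v +
        φ' (u p) * lineDeriv 𝕜 (fun x => lineDeriv 𝕜 u x v) p w := by
  have hfirst : (fun x => lineDeriv 𝕜 (φ ∘ u) x v) =ᶠ[𝓝 p]
      fun x => (φ' ∘ u) x * lineDeriv 𝕜 u x v := by
    filter_upwards [hu.continuousAt.eventually hφ, hu.eventually (by simp)] with x hφx hux
    exact lineDeriv_comp hφx (hux.differentiableAt two_ne_zero).lineDifferentiableAt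
  have hu' := (hu.differentiableAt two_ne_zero).lineDifferentiableAt (v := w)
  have hcomp : LineDifferentiableAt 𝕜 (φ' ∘ u) p w :=
    (hφ'.differentiableAt.comp p (hu.differentiableAt two_ne_zero)).lineDifferentiableAt
  have hprod := hcomp.hasLineDerivAt.mul
    ((differentiableAt_lineDeriv hu v).lineDifferentiableAt (v := w)).hasLineDerivAt
  rw [hfirst.lineDeriv_eq]
  refine hprod.deriv.trans ?_
  simp only [zero_smul, add_zero, Function.comp_apply, lineDeriv_comp hφ' hu']

end LineDeriv

section Plane

variable {u : ℝ × ℝ → ℝ} {p : ℝ × ℝ}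

theorem partialX_eq_lineDeriv (u : ℝ × ℝ → ℝ) : partialX u = fun p => lineDeriv ℝ u p (1, 0) := by
  ext ⟨x, y⟩
  simpa [partialX, lineDeriv] using (deriv_comp_const_add (fun s => u (s, y)) x 0).symm

theorem partialY_eq_lineDeriv (u : ℝ × ℝ → ℝ) : partialY u = fun p => lineDeriv ℝ u p (0, 1) := by
  ext ⟨x, y⟩
  simpa [partialY, lineDeriv] using (deriv_comp_const_add (fun s => u (x, s)) y 0).symm

/-- The Laplacian `u_xx + u_yy`. -/
noncomputable def planeLaplacian (u : ℝ × ℝ → ℝ) (p : ℝ × ℝ) : ℝ :=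
  partialX (partialX u) p + partialY (partialY u) p

/-- The squared Euclidean length `|∇u|²` of the gradient. -/
noncomputable def gradientNormSq (u : ℝ × ℝ → ℝ) (p : ℝ × ℝ) : ℝ :=
  partialX u p ^ 2 + partialY u p ^ 2

/-- The Hessian of `u` evaluated twice on the rotated gradient `(-u_y, u_x)`, that is `|∇u|³` times
the curvature of the level curve, up to sign. -/
noncomputable def levelHessian (u : ℝ × ℝ → ℝ) (p : ℝ × ℝ) : ℝ :=
  partialY u p ^ 2 * partialX (partialX u) p -
    2 * partialX u p * partialY u p * partialY (partialX u) p +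
      partialX u p ^ 2 * partialY (partialY u) p

theorem spaceLikeAt_iff_gradientNormSq_lt_one : SpaceLikeAt u p ↔ gradientNormSq u p < 1 := by
  rw [SpaceLikeAt, Real.sqrt_lt' one_pos, one_pow, gradientNormSq]

theorem gradientNormSq_comp {φ : ℝ → ℝ} {φ' : ℝ} (hφ : HasDerivAt φ φ' (u p))
    (hu : DifferentiableAt ℝ u p) :
    gradientNormSq (φ ∘ u) p = φ' ^ 2 * gradientNormSq u p := by
  simp only [gradientNormSq, partialX_eq_lineDeriv, partialY_eq_lineDeriv,
    lineDeriv_comp hφ hu.lineDifferentiableAt]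
  ring

theorem maximalSurfaceEqAt_comp_iff {φ φ' : ℝ → ℝ} {φ'' : ℝ} (hu : ContDiffAt ℝ 2 u p)
    (hφ : ∀ᶠ c in 𝓝 (u p), HasDerivAt φ (φ' c) c) (hφ' : HasDerivAt φ' φ'' (u p)) :
    MaximalSurfaceEqAt (φ ∘ u) p ↔
      φ' (u p) * planeLaplacian u p + φ'' * gradientNormSq u p =
        φ' (u p) ^ 3 * levelHessian u p := by
  have hu' := hu.differentiableAt two_ne_zero
  simp only [MaximalSurfaceEqAt, planeLaplacian, gradientNormSq, levelHessian,
    partialX_eq_lineDeriv, partialY_eq_lineDeriv, lineDeriv_lineDeriv_comp hu hφ hφ',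
    lineDeriv_comp hφ.self_of_nhds hu'.lineDifferentiableAt]
  constructor <;> intro h <;> linear_combination h

theorem maximalSurfaceEqAt_comp_of_hasDerivAt_div_sqrt {φ R : ℝ → ℝ} {β R' : ℝ}
    (hu : ContDiffAt ℝ 2 u p) (hφ : ∀ᶠ c in 𝓝 (u p), HasDerivAt φ (β / √(R c)) c)
    (hR : HasDerivAt R R' (u p)) (hpos : 0 < R (u p))
    (heq : R (u p) * planeLaplacian u p - R' / 2 * gradientNormSq u p = β ^ 2 * levelHessian u p) :
    MaximalSurfaceEqAt (φ ∘ u) p := by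
  have hsqrt := Real.sqrt_pos.2 hpos
  rw [maximalSurfaceEqAt_comp_iff hu hφ
    ((hasDerivAt_const (u p) β).fun_div (hR.sqrt hpos.ne') hsqrt.ne')]
  rw [← Real.sq_sqrt hpos.le] at heq
  field_simp at heq ⊢
  linear_combination β * heq

end Plane

/-- The function `q(x, y) = cos (a x) / cosh (a y)`, the value prescribed for `sn`. -/
noncomputable def cosDivCosh (a : ℝ) (p : ℝ × ℝ) : ℝ :=
  Real.cos (a * p.1) / Real.cosh (a * p.2)

section CosDivCosh

variable (a : ℝ) (p : ℝ × ℝ)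

theorem contDiff_cosDivCosh {n : WithTop ℕ∞} : ContDiff ℝ n (cosDivCosh a) := by
  unfold cosDivCosh
  fun_prop (disch := intro; positivity)

theorem partialX_cosDivCosh : partialX (cosDivCosh a) =
    fun p => -(a * Real.sin (a * p.1) / Real.cosh (a * p.2)) := by
  ext p
  have h := (((hasDerivAt_id p.1).const_mul a).cos).div_const (Real.cosh (a * p.2))
  refine h.deriv.trans ?_
  simp only [id]
  ring

theorem partialY_cosDivCosh : partialY (cosDivCosh a) =
    fun p => -(a * Real.cos (a * p.1) * Real.sinh (a * p.2) / Real.cosh (a * p.2) ^ 2) := by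
  ext p
  have hne := (Real.cosh_pos (a * p.2)).ne'
  have h := (hasDerivAt_const p.2 (Real.cos (a * p.1))).fun_div
    ((hasDerivAt_id p.2).const_mul a).cosh hne
  refine h.deriv.trans ?_
  simp only [id]
  field_simp
  ring

theorem partialX_partialX_cosDivCosh :
    partialX (partialX (cosDivCosh a)) p = -a ^ 2 * cosDivCosh a p := by
  have hlin := (hasDerivAt_id p.1).const_mul a
  have h := ((hlin.sin.const_mul a).div_const (Real.cosh (a * p.2))).neg
  rw [partialX_cosDivCosh, cosDivCosh]
  refine h.deriv.trans ?_
  simp only [id]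
  ring

theorem partialY_partialX_cosDivCosh : partialY (partialX (cosDivCosh a)) p =
    a ^ 2 * Real.sin (a * p.1) * Real.sinh (a * p.2) / Real.cosh (a * p.2) ^ 2 := by
  have hne := (Real.cosh_pos (a * p.2)).ne'
  have h := ((hasDerivAt_const p.2 (a * Real.sin (a * p.1))).fun_div
    ((hasDerivAt_id p.2).const_mul a).cosh hne).neg
  rw [partialX_cosDivCosh]
  refine h.deriv.trans ?_
  simp only [id]
  field_simp
  ring

theorem partialY_partialY_cosDivCosh : partialY (partialY (cosDivCosh a)) p =
    a ^ 2 * (1 - 2 / Real.cosh (a * p.2) ^ 2) * cosDivCosh a p := by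
  have hne := (Real.cosh_pos (a * p.2)).ne'
  have hlin := (hasDerivAt_id p.2).const_mul a
  have h := ((hlin.sinh.const_mul (a * Real.cos (a * p.1))).fun_div
    (hlin.cosh.fun_pow 2) (pow_ne_zero 2 hne)).neg
  rw [partialY_cosDivCosh, cosDivCosh]
  refine h.deriv.trans ?_
  simp only [id]
  field_simp
  rw [Real.sinh_sq]
  ring

theorem planeLaplacian_cosDivCosh : planeLaplacian (cosDivCosh a) p =
    -2 * a ^ 2 * cosDivCosh a p / Real.cosh (a * p.2) ^ 2 := by
  rw [planeLaplacian, partialX_partialX_cosDivCosh, partialY_partialY_cosDivCosh]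
  ring

theorem gradientNormSq_cosDivCosh : gradientNormSq (cosDivCosh a) p =
    a ^ 2 * (1 - cosDivCosh a p ^ 2) / Real.cosh (a * p.2) ^ 2 := by
  rw [gradientNormSq, partialX_cosDivCosh, partialY_cosDivCosh, cosDivCosh]
  have hne := (Real.cosh_pos (a * p.2)).ne'
  field_simp
  rw [Real.sin_sq, Real.sinh_sq]
  ring

theorem levelHessian_cosDivCosh : levelHessian (cosDivCosh a) p =
    -a ^ 4 * cosDivCosh a p * (1 - cosDivCosh a p ^ 2) / Real.cosh (a * p.2) ^ 2 := by
  rw [levelHessian, partialX_partialX_cosDivCosh, partialY_partialX_cosDivCosh,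
    partialY_partialY_cosDivCosh, partialX_cosDivCosh, partialY_cosDivCosh, cosDivCosh]
  have hne := (Real.cosh_pos (a * p.2)).ne'
  field_simp
  rw [Real.sin_sq, Real.sinh_sq]
  ring

end CosDivCosh

section EllipticIntegral

variable {k c : ℝ}

theorem ellipticF_neg (k φ : ℝ) : ellipticF k (-φ) = -ellipticF k φ := by
  have h := intervalIntegral.integral_comp_neg (a := 0) (b := φ)
    fun θ => 1 / √(1 - k ^ 2 * Real.sin θ ^ 2)
  simp only [Real.sin_neg, neg_sq, neg_zero] at h
  rw [ellipticF, ellipticF, h, intervalIntegral.integral_symm]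

theorem strictMono_ellipticF (hk : |k| < 1) : StrictMono (ellipticF k) := by
  have h := (ellipticF_sub_id_monotone hk).add_strictMono strictMono_id
  simpa only [id, sub_add_cancel] using h

theorem continuous_ellipticF (hk : |k| < 1) : Continuous (ellipticF k) :=
  continuous_iff_continuousAt.2 fun φ => (ellipticF_hasDerivAt hk φ).continuousAt

theorem analyticAt_ellipticF (hk : |k| < 1) (φ : ℝ) : AnalyticAt ℝ (ellipticF k) φ := by
  have hpos := ellipticF_integrand_pos hk φ
  have hintegrand : ContDiffAt ℝ ω (fun θ => 1 / √(1 - k ^ 2 * Real.sin θ ^ 2)) φ :=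
    contDiffAt_const.div (ContDiffAt.sqrt (by fun_prop) hpos.ne') (Real.sqrt_pos.2 hpos).ne'
  exact analyticAt_of_eventually_hasDerivAt hintegrand.analyticAt
    (.of_forall (ellipticF_hasDerivAt hk))

theorem jacobiSn_ellipticF (hk : |k| < 1) (φ : ℝ) : jacobiSn (ellipticF k φ) k = Real.sin φ := by
  rw [jacobiSn, jacobiAm, Function.leftInverse_invFun (ellipticF_bijective hk).injective]

theorem abs_ellipticF_le_ellipticK_iff (hk : |k| < 1) {φ : ℝ} :
    |ellipticF k φ| ≤ ellipticK k ↔ |φ| ≤ Real.pi / 2 := by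
  rw [ellipticK, abs_le, abs_le, ← ellipticF_neg, (strictMono_ellipticF hk).le_iff_le,
    (strictMono_ellipticF hk).le_iff_le]

/-- The inverse of `t ↦ sn(t; k)` on `[-K(k), K(k)]`. Like `Real.arcsin` it is extended by constants
outside `[-1, 1]`. -/
noncomputable def jacobiArcsn (k c : ℝ) : ℝ := ellipticF k (Real.arcsin c)

theorem abs_le_ellipticK_and_jacobiSn_eq_iff (hk : |k| < 1) (hc : c ∈ Set.Icc (-1) 1) {t : ℝ} :
    |t| ≤ ellipticK k ∧ jacobiSn t k = c ↔ t = jacobiArcsn k c := by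
  obtain ⟨φ, rfl⟩ := (ellipticF_bijective hk).surjective t
  rw [jacobiSn_ellipticF hk, abs_ellipticF_le_ellipticK_iff hk, jacobiArcsn,
    (ellipticF_bijective hk).injective.eq_iff, abs_le]
  constructor
  · rintro ⟨⟨hl, hr⟩, rfl⟩
    exact (Real.arcsin_sin hl hr).symm
  · rintro rfl
    exact ⟨Real.arcsin_mem_Icc c, Real.sin_arcsin hc.1 hc.2⟩

theorem continuous_jacobiArcsn (hk : |k| < 1) : Continuous (jacobiArcsn k) :=
  (continuous_ellipticF hk).comp Real.continuous_arcsin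

theorem analyticAt_jacobiArcsn (hk : |k| < 1) (hc : c ^ 2 < 1) :
    AnalyticAt ℝ (jacobiArcsn k) c := by
  obtain ⟨hl, hr⟩ := sq_lt_one_iff_abs_lt_one c |>.1 hc |> abs_lt.1
  exact (analyticAt_ellipticF hk _).comp (Real.contDiffAt_arcsin hl.ne' hr.ne).analyticAt

theorem hasDerivAt_jacobiArcsn (hk : |k| < 1) (hc : c ^ 2 < 1) :
    HasDerivAt (jacobiArcsn k) (1 / √((1 - c ^ 2) * (1 - k ^ 2 * c ^ 2))) c := by
  obtain ⟨hl, hr⟩ := sq_lt_one_iff_abs_lt_one c |>.1 hc |> abs_lt.1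
  refine ((ellipticF_hasDerivAt hk _).comp c (Real.hasDerivAt_arcsin hl.ne' hr.ne)).congr_deriv ?_
  rw [Real.sin_arcsin hl.le hr.le, Real.sqrt_mul (by linarith), one_div_mul_one_div, mul_comm]

end EllipticIntegral

section SingularPoints

variable {a : ℝ} {p : ℝ × ℝ}

theorem mem_singularPoints_iff (ha : a ≠ 0) :
    p ∈ singularPoints a ↔ Real.sin (a * p.1) = 0 ∧ p.2 = 0 := by
  simp only [singularPoints, Set.mem_ofPred_eq, Prod.ext_iff, exists_and_right,
    Real.sin_eq_zero_iff]
  refine and_congr_left fun _ => exists_congr fun n => ?_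
  rw [eq_div_iff ha]
  constructor <;> intro h <;> linarith

theorem isClosed_singularPoints (ha : a ≠ 0) : IsClosed (singularPoints a) := by
  have heq : singularPoints a = {p | Real.sin (a * p.1) = 0} ∩ {p | p.2 = 0} :=
    Set.ext fun _ => mem_singularPoints_iff ha
  rw [heq]
  exact (isClosed_eq (by fun_prop) continuous_const).inter
    (isClosed_eq continuous_snd continuous_const)

theorem sin_sq_add_sinh_sq_pos (ha : a ≠ 0) (hp : p ∉ singularPoints a) :
    0 < Real.sin (a * p.1) ^ 2 + Real.sinh (a * p.2) ^ 2 := by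
  contrapose! hp
  have hsin : Real.sin (a * p.1) = 0 := by nlinarith
  have hsinh : Real.sinh (a * p.2) = 0 := by nlinarith
  exact (mem_singularPoints_iff ha).2 ⟨hsin, by simpa [ha] using hsinh⟩

theorem cosDivCosh_mem_Icc (a : ℝ) (p : ℝ × ℝ) : cosDivCosh a p ∈ Set.Icc (-1) 1 := by
  have hcosh := Real.cosh_pos (a * p.2)
  rw [cosDivCosh, Set.mem_Icc, ← abs_le, abs_div, abs_of_pos hcosh, div_le_one hcosh]
  exact (Real.abs_cos_le_one _).trans (Real.one_le_cosh _)

theorem cosDivCosh_sq_lt_one (ha : a ≠ 0) (hp : p ∉ singularPoints a) :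
    cosDivCosh a p ^ 2 < 1 := by
  have hpos := sin_sq_add_sinh_sq_pos ha hp
  rw [cosDivCosh, div_pow, div_lt_one (by positivity), Real.cosh_sq', Real.cos_sq']
  linarith

end SingularPoints

section MaximalGraph

variable {a α : ℝ} {p : ℝ × ℝ}

/-- The function `u_{a,α}`: the solution `z` of `sn(a z / √(1 - α²); α) = cos (a x) / cosh (a y)`
with `|a z / √(1 - α²)| ≤ K(α)`. -/
noncomputable def maximalGraph (a α : ℝ) : ℝ × ℝ → ℝ :=
  (fun c => √(1 - α ^ 2) / a * jacobiArcsn α c) ∘ cosDivCosh a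

theorem abs_le_ellipticK_and_jacobiSn_eq_cosDivCosh_iff (ha : a ≠ 0) (hα : |α| < 1) {z : ℝ} :
    |a * z / √(1 - α ^ 2)| ≤ ellipticK α ∧ jacobiSn (a * z / √(1 - α ^ 2)) α = cosDivCosh a p ↔
      z = maximalGraph a α p := by
  have hsqrt : √(1 - α ^ 2) ≠ 0 :=
    (Real.sqrt_pos.2 <| sub_pos.2 <| (sq_lt_one_iff_abs_lt_one α).2 hα).ne'
  rw [abs_le_ellipticK_and_jacobiSn_eq_iff hα (cosDivCosh_mem_Icc a p), maximalGraph,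
    Function.comp_apply, div_eq_iff hsqrt, div_mul_eq_mul_div, eq_div_iff ha, mul_comm a,
    mul_comm (jacobiArcsn _ _)]

theorem continuous_maximalGraph (hα : |α| < 1) : Continuous (maximalGraph a α) :=
  (continuous_const.mul (continuous_jacobiArcsn hα)).comp
    (contDiff_cosDivCosh (n := 0) a).continuous

theorem analyticAt_maximalGraph (ha : a ≠ 0) (hα : |α| < 1) (hp : p ∉ singularPoints a) :
    AnalyticAt ℝ (maximalGraph a α) p :=
  AnalyticAt.comp
    (analyticAt_const.mul (analyticAt_jacobiArcsn hα (cosDivCosh_sq_lt_one ha hp)))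
    (contDiff_cosDivCosh a).contDiffAt.analyticAt

theorem hasDerivAt_const_mul_jacobiArcsn (hα : |α| < 1) {c : ℝ} (hc : c ^ 2 < 1) (β : ℝ) :
    HasDerivAt (fun c => β * jacobiArcsn α c) (β / √((1 - c ^ 2) * (1 - α ^ 2 * c ^ 2))) c :=
  ((hasDerivAt_jacobiArcsn hα hc).const_mul β).congr_deriv (mul_one_div _ _)

theorem gradientNormSq_maximalGraph (ha : a ≠ 0) (hα : |α| < 1) (hp : p ∉ singularPoints a) :
    gradientNormSq (maximalGraph a α) p =
      (1 - α ^ 2) / (Real.cosh (a * p.2) ^ 2 - α ^ 2 * Real.cos (a * p.1) ^ 2) := by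
  have hα' := (sq_lt_one_iff_abs_lt_one α).2 hα
  have hq := cosDivCosh_sq_lt_one ha hp
  have hcosh := (Real.cosh_pos (a * p.2)).ne'
  have hfac : 0 < 1 - cosDivCosh a p ^ 2 := by linarith
  have hfac' : 0 < 1 - α ^ 2 * cosDivCosh a p ^ 2 := by nlinarith [sq_nonneg α]
  have hden : Real.cosh (a * p.2) ^ 2 - α ^ 2 * Real.cos (a * p.1) ^ 2 =
      Real.cosh (a * p.2) ^ 2 * (1 - α ^ 2 * cosDivCosh a p ^ 2) := by
    rw [cosDivCosh]
    field_simp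
  rw [maximalGraph, gradientNormSq_comp (hasDerivAt_const_mul_jacobiArcsn hα hq _)
      ((contDiff_cosDivCosh a).differentiable one_ne_zero _), gradientNormSq_cosDivCosh, hden,
    div_pow, div_pow, Real.sq_sqrt (by linarith), Real.sq_sqrt (by positivity)]
  field_simp

theorem spaceLikeAt_maximalGraph (ha : a ≠ 0) (hα : |α| < 1) (hα₀ : α ≠ 0)
    (hp : p ∉ singularPoints a) : SpaceLikeAt (maximalGraph a α) p := by
  have hα' : 0 < 1 - α ^ 2 := sub_pos.2 ((sq_lt_one_iff_abs_lt_one α).2 hα)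
  have hpos := sin_sq_add_sinh_sq_pos ha hp
  have hlt : 1 - α ^ 2 < Real.cosh (a * p.2) ^ 2 - α ^ 2 * Real.cos (a * p.1) ^ 2 := by
    have h : 0 < α ^ 2 * (Real.sin (a * p.1) ^ 2 + Real.sinh (a * p.2) ^ 2) := by positivity
    rw [Real.cosh_sq', Real.cos_sq']
    nlinarith [sq_nonneg (Real.sinh (a * p.2))]
  rwa [spaceLikeAt_iff_gradientNormSq_lt_one, gradientNormSq_maximalGraph ha hα hp,
    div_lt_one (hα'.trans hlt)]

theorem maximalSurfaceEqAt_maximalGraph (ha : a ≠ 0) (hα : |α| < 1) (hp : p ∉ singularPoints a) :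
    MaximalSurfaceEqAt (maximalGraph a α) p := by
  have hα' := (sq_lt_one_iff_abs_lt_one α).2 hα
  have hq := cosDivCosh_sq_lt_one ha hp
  set q := cosDivCosh a p with hq_def
  have hR : HasDerivAt (fun c => (1 - c ^ 2) * (1 - α ^ 2 * c ^ 2))
      (-(2 * q) * (1 - α ^ 2 * q ^ 2) + (1 - q ^ 2) * -(α ^ 2 * (2 * q))) q := by
    have hsq : HasDerivAt (fun c : ℝ => c ^ 2) (2 * q) q := by simpa using hasDerivAt_pow 2 q
    exact (hsq.const_sub 1).mul ((hsq.const_mul (α ^ 2)).const_sub 1)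
  refine maximalSurfaceEqAt_comp_of_hasDerivAt_div_sqrt (β := √(1 - α ^ 2) / a)
    (contDiff_cosDivCosh a).contDiffAt ?_ hR ?_ ?_
  · filter_upwards [(continuous_pow 2).continuousAt.eventually_lt_const hq] with c hc
    exact hasDerivAt_const_mul_jacobiArcsn hα hc _
  · exact mul_pos (by linarith) (by nlinarith [sq_nonneg α])
  · rw [planeLaplacian_cosDivCosh, gradientNormSq_cosDivCosh, levelHessian_cosDivCosh, ← hq_def,
      div_pow, Real.sq_sqrt (by linarith)]
    field_simp
    ring

theorem partialY_maximalGraph_of_snd_eq_zero (hp : p.2 = 0) :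
    partialY (maximalGraph a α) p = 0 := by
  have heven : (fun s => maximalGraph a α (p.1, -s)) = fun s => maximalGraph a α (p.1, s) := by
    ext s
    simp only [maximalGraph, Function.comp_apply, cosDivCosh, mul_neg, Real.cosh_neg]
  have h := deriv_comp_neg (fun s => maximalGraph a α (p.1, s)) 0
  rw [heven, neg_zero] at h
  rw [partialY, hp]
  linarith

theorem partialX_maximalGraph_of_sin_eq_zero (ha : a ≠ 0) (hα : |α| < 1)
    (hsin : Real.sin (a * p.1) = 0) (hp : p ∉ singularPoints a) :
    partialX (maximalGraph a α) p = 0 := by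
  have hq : partialX (cosDivCosh a) p = 0 := by simp [partialX_cosDivCosh, hsin]
  simp only [partialX_eq_lineDeriv] at hq ⊢
  rw [maximalGraph, lineDeriv_comp
    (hasDerivAt_const_mul_jacobiArcsn hα (cosDivCosh_sq_lt_one ha hp) _)
    ((contDiff_cosDivCosh a).differentiable one_ne_zero p).lineDifferentiableAt, hq, mul_zero]

theorem partialY_maximalGraph_sq_of_sin_eq_zero (ha : a ≠ 0) (hα : |α| < 1)
    (hsin : Real.sin (a * p.1) = 0) (hp : p.2 ≠ 0) :
    partialY (maximalGraph a α) p ^ 2 = (1 - α ^ 2) / (Real.cosh (a * p.2) ^ 2 - α ^ 2) := by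
  have hp' : p ∉ singularPoints a := fun h => hp ((mem_singularPoints_iff ha).1 h).2
  have h := gradientNormSq_maximalGraph ha hα hp'
  rwa [gradientNormSq, partialX_maximalGraph_of_sin_eq_zero ha hα hsin hp', Real.cos_sq', hsin,
    zero_pow two_ne_zero, zero_add, sub_zero, mul_one] at h

theorem not_contDiffAt_maximalGraph (ha : a ≠ 0) (hα : |α| < 1) (hp : p ∈ singularPoints a) :
    ¬ ContDiffAt ℝ 1 (maximalGraph a α) p := by
  obtain ⟨hsin, hp₂⟩ := (mem_singularPoints_iff ha).1 hp
  obtain ⟨x, y⟩ := p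
  obtain rfl : y = 0 := hp₂
  intro h
  have hα' : 1 - α ^ 2 ≠ 0 := (sub_pos.2 ((sq_lt_one_iff_abs_lt_one α).2 hα)).ne'
  have hcont : ContinuousAt (partialY (maximalGraph a α)) (x, 0) := by
    rw [partialY_eq_lineDeriv]
    exact continuousAt_lineDeriv h (0, 1)
  have hline : Tendsto (fun s => partialY (maximalGraph a α) (x, s) ^ 2) (𝓝[≠] 0) (𝓝 0) := by
    have h := (hcont.comp (Continuous.prodMk_right x).continuousAt).pow 2
    rw [ContinuousAt, Pi.pow_apply, Function.comp_apply, partialY_maximalGraph_of_snd_eq_zero rfl,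
      zero_pow two_ne_zero] at h
    exact h.mono_left nhdsWithin_le_nhds
  have hlimit : Tendsto (fun s => partialY (maximalGraph a α) (x, s) ^ 2) (𝓝[≠] 0) (𝓝 1) := by
    have h : ContinuousAt (fun s => (1 - α ^ 2) / (Real.cosh (a * s) ^ 2 - α ^ 2)) 0 :=
      continuousAt_const.div (by fun_prop) (by simpa using hα')
    rw [ContinuousAt, mul_zero, Real.cosh_zero, one_pow, div_self hα'] at h
    refine (h.mono_left nhdsWithin_le_nhds).congr' ?_
    filter_upwards [self_mem_nhdsWithin] with s hs
    exact (partialY_maximalGraph_sq_of_sin_eq_zero (p := (x, s)) ha hα hsin hs).symm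
  exact zero_ne_one (tendsto_nhds_unique hline hlimit)

end MaximalGraph

theorem mainTheorem2 (a α : ℝ) (ha : 0 < a) (hα : α ∈ Set.Ioo (0 : ℝ) 1) :
    ∃ u : ℝ × ℝ → ℝ,
      (∀ x y z : ℝ,
        (|a * z / Real.sqrt (1 - α ^ 2)| ≤ ellipticK α ∧
          jacobiSn (a * z / Real.sqrt (1 - α ^ 2)) α
            = Real.cos (a * x) / Real.cosh (a * y)) ↔ z = u (x, y)) ∧
      Continuous u ∧
      IsSpaceLikeSolutionOn u (singularPoints a)ᶜ ∧
      AnalyticOnNhd ℝ u (singularPoints a)ᶜ ∧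
      ∀ p ∈ singularPoints a, ¬ AnalyticAt ℝ u p := by
  have hα' : |α| < 1 := abs_lt.2 ⟨by linarith [hα.1], hα.2⟩
  have hanalytic : AnalyticOnNhd ℝ (maximalGraph a α) (singularPoints a)ᶜ := fun _ hp =>
    analyticAt_maximalGraph ha.ne' hα' hp
  refine ⟨maximalGraph a α,
    fun x y _ => abs_le_ellipticK_and_jacobiSn_eq_cosDivCosh_iff (p := (x, y)) ha.ne' hα',
    continuous_maximalGraph hα', ⟨(isClosed_singularPoints ha.ne').isOpen_compl,
      fun p hp => (hanalytic p hp).contDiffAt.contDiffWithinAt,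
      fun _ hp => spaceLikeAt_maximalGraph ha.ne' hα' hα.1.ne' hp,
      fun _ hp => maximalSurfaceEqAt_maximalGraph ha.ne' hα' hp⟩, hanalytic,
    fun _ hp h => not_contDiffAt_maximalGraph ha.ne' hα' hp h.contDiffAt⟩
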